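/- Let $G$ be a compact, connected (real, finite-dimensional, smooth) Lie group with identity $e$ and Lie algebra $\mathfrak g\cong T_eG$ of left-invariant vector fields, let $X_1,\dots,X_m\in\mathfrak g$, and let $T>0$. Let $(x_r,u^r_1,\dots,u^r_m)$ be a $T$-periodic trajectory of the left-invariant driftless system $x'=\sum_{k=1}^m u_kX_k(x)$; that is, $u^r_1,\dots,u^r_m:\mathbb R\to\mathbb R$ are smooth and $T$-periodic, and $x_r:\mathbb R\to G$ is $T$-periodic and satisfies $x_r'(t)=\sum_{k=1}^m u^r_k(t)X_k(x_r(t))$ for all $t\in\mathbb R$. For $x\in G$ let $\mathrm{Ad}(x):\mathfrak g\to\mathfrak g$ be the differential at $e$ of $y\mapsto xyx^{-1}$, and put $V(x)=\operatorname{tr}\mathrm{Ad}(x)$. For $(t,w)\in\mathbb R\times G$ define $$a_k(t,w)=\mathrm dV\big((\mathrm{Ad}(x_r(t))X_k)(w)\big)\quad(1\le k\le m),\qquad W(t,w)=\sum_{k=1}^m a_k(t,w)\,(\mathrm{Ad}(x_r(t))X_k)(w),$$ where $(\mathrm{Ad}(x_r(t))X_k)(w)\in T_wG$ is the value at $w$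 of the left-invariant vector field $\mathrm{Ad}(x_r(t))X_k$. For $(t_0,w_0)\in\mathbb R\times G$ let $\omega_W(t_0,w_0)$ be the set of all $w\in G$ for which there is an increasing sequence $t_n\to\infty$ with $\mathbf w(t_n)\to w$, where $\mathbf w:\mathbb R\to G$ is the integral curve of the time-dependent vector field $W$ with $\mathbf w(t_0)=w_0$. Then for every $(t_0,w_0)\in\mathbb R\times G$ and every $w\in\omega_W(t_0,w_0)$, $$a_k(t,w)=0\quad\text{for all }t\in\mathbb R\text{ and all }k\in\{1,\dots,m\}.$$ In particular, every $\omega$-limit point $w$ of $W$ is a critical point of $W$, i.e. $W(t,w)=0$ for all $t\in\mathbb R$. -/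

import Mathlib

open Filter Topology
open scoped Manifold ContDiff

noncomputable section

namespace PeriodicTracking

section TimeDependent

variable {E : Type*} [NormedAddCommGroup E] [NormedSpace ℝ E]
  {H : Type*} [TopologicalSpace H] (I : ModelWithCorners ℝ E H)
  {M : Type*} [TopologicalSpace M] [ChartedSpace H M]

/-- `γ : ℝ → M` is a (global) integral curve of the time-dependent vector field `X`:
`γ' t = X (t, γ t)` for every `t`. -/
def IsTimeIntegralCurve (X : ℝ → (x : M) → TangentSpace I x) (γ : ℝ → M) : Prop :=
  ∀ t : ℝ, HasMFDerivAt 𝓘(ℝ, ℝ) I γ t ((1 : ℝ →L[ℝ] ℝ).smulRight (X t (γ t)))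

/-- The `ω`-limit set of `(t₀, x₀)` for the time-dependent vector field `X`: all limits of
`γ (s n)`, where `γ` is the integral curve of `X` with `γ t₀ = x₀` and `s` is an increasing
sequence of times tending to infinity. -/
def omegaLimitSet (X : ℝ → (x : M) → TangentSpace I x) (t₀ : ℝ) (x₀ : M) : Set M :=
  {x | ∃ γ : ℝ → M, IsTimeIntegralCurve I X γ ∧ γ t₀ = x₀ ∧
    ∃ s : ℕ → ℝ, StrictMono s ∧ Tendsto s atTop atTop ∧ Tendsto (fun n => γ (s n)) atTop (𝓝 x)}

/-- The critical points of a time-dependent vector field: the points where it vanishes at all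
times. -/
def criticalPoints (X : ℝ → (x : M) → TangentSpace I x) : Set M :=
  {x | ∀ t : ℝ, X t x = 0}

end TimeDependent

section LieGroup

variable {E : Type*} [NormedAddCommGroup E] [NormedSpace ℝ E]
  {H : Type*} [TopologicalSpace H] (I : ModelWithCorners ℝ E H)
  {G : Type*} [TopologicalSpace G] [ChartedSpace H G] [Group G]

/-- The adjoint map: `Ad x` is the differential at the identity of `y ↦ x * y * x⁻¹`. -/
def Ad (x : G) : GroupLieAlgebra I G →L[ℝ] GroupLieAlgebra I G :=
  mfderiv I I (fun y : G => x * y * x⁻¹) 1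

/-- The Lyapunov-like function `V x = tr (Ad x)`. -/
def lyapunovV (x : G) : ℝ :=
  LinearMap.trace ℝ (GroupLieAlgebra I G) (Ad I x).toLinearMap

/-- `(x, u₁, …, u_m)` is a smooth trajectory of the left-invariant driftless system
`x' = ∑ k, u k • X k (x)`; a left-invariant vector field is given by its value at the identity. -/
structure IsTrajectory {m : ℕ} (X : Fin m → GroupLieAlgebra I G)
    (x : ℝ → G) (u : Fin m → ℝ → ℝ) : Prop where
  contDiff_control : ∀ k, ContDiff ℝ ∞ (u k)
  isTimeIntegralCurve : IsTimeIntegralCurve I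
    (fun t g => ∑ k, u k t • mulInvariantVectorField (X k) g) x

/-- A `T`-periodic trajectory: a trajectory whose curve and controls are all `T`-periodic,
with `T > 0`. -/
structure IsPeriodicTrajectory {m : ℕ} (X : Fin m → GroupLieAlgebra I G) (T : ℝ)
    (x : ℝ → G) (u : Fin m → ℝ → ℝ) : Prop extends IsTrajectory I X x u where
  period_pos : 0 < T
  periodic_curve : Function.Periodic x T
  periodic_control : ∀ k, Function.Periodic (u k) T

/-- The left-invariant vector field `Ad (xr t) (X k)`, evaluated at `w`. -/
def adField {m : ℕ} (X : Fin m → GroupLieAlgebra I G) (xr : ℝ → G) (k : Fin m)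
    (t : ℝ) (w : G) : TangentSpace I w :=
  mulInvariantVectorField (Ad I (xr t) (X k)) w

/-- The feedback functions `a k (t, w) = dV (Ad (xr t) (X k) (w))`. -/
def feedback {m : ℕ} (X : Fin m → GroupLieAlgebra I G) (xr : ℝ → G) (k : Fin m)
    (t : ℝ) (w : G) : ℝ :=
  mfderiv I 𝓘(ℝ, ℝ) (lyapunovV I : G → ℝ) w (adField I X xr k t w)

/-- The auxiliary vector field `W (t, w) = ∑ k, a k (t, w) • Ad (xr t) (X k) (w)`. -/
def auxField {m : ℕ} (X : Fin m → GroupLieAlgebra I G) (xr : ℝ → G)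
    (t : ℝ) (w : G) : TangentSpace I w :=
  ∑ k, feedback I X xr k t w • adField I X xr k t w

end LieGroup

end PeriodicTracking

end

/-! For `A = Ad ∘ γ` the auxiliary equation becomes `A' = ∑ k, tr (Z k) • Z k`, where `Z k = A * ad
(Ad (xr t) (X k))` is periodic in time: a gradient-like equation for the trace in a space of
endomorphisms. Along it `tr A` grows at the rate `∑ k, tr (Z k) ^ 2`, and it converges, because it
is monotone and converges along the given sequence of times. By the Cauchy–Schwarz inequality the
speed of `A` near the limit point is at most a multiple of the square root of that rate, so over a
bounded time window `A` moves by at most a multiple of the square root of the increment of `tr A`,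
which tends to zero. Thus, from late times of the sequence on, `A` rests near its limit for more
than a whole period, and a nonzero `tr (Z k)` at some phase would force a definite growth of `tr A`
within each such window. -/

namespace PeriodicTracking

open Set Function

section Displacement

variable {F : Type*} [NormedAddCommGroup F] [NormedSpace ℝ F] {A A' : ℝ → F} {V v : ℝ → ℝ}
  {C ρ : ℝ}

theorem norm_sub_le_of_norm_deriv_sq_le (hA : ∀ t, HasDerivAt A (A' t) t)
    (hV : ∀ t, HasDerivAt V (v t) t) (hv : ∀ t, 0 ≤ v t) (hC : 0 ≤ C) {η a b : ℝ} (hη : 0 < η)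
    (hbound : ∀ t, ‖A t - A a‖ ≤ ρ → ‖A' t‖ ^ 2 ≤ C * v t)
    (hρ : η * (b - a) + C / η * (V b - V a) ≤ ρ) {t : ℝ} (ht : t ∈ Icc a b) :
    ‖A t - A a‖ ≤ ρ := by
  have hVmono : Monotone V := monotone_of_hasDerivAt_nonneg hV hv
  have hbarrier_le : ∀ x ≤ b, η * (x - a) + C / η * (V x - V a) ≤ ρ := fun x hx =>
    hρ.trans' (by have := hVmono hx; gcongr)
  have hspeed : ∀ x, ‖A' x‖ ^ 2 ≤ C * v x → ‖A' x‖ < η + C / η * v x := fun x hx => by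
    have hamgm : 2 * ‖A' x‖ * η ≤ C * v x + η ^ 2 := (two_mul_le_add_sq _ _).trans (by gcongr)
    have hpos : 0 ≤ C * v x := mul_nonneg hC (hv x)
    have hexpand : (η + C / η * v x) * η = η ^ 2 + C * v x := by field_simp
    rw [← mul_lt_mul_iff_left₀ hη, hexpand]
    linarith [pow_pos hη 2]
  refine (image_norm_le_of_norm_deriv_right_lt_deriv_boundary
    (B := fun x => η * (x - a) + C / η * (V x - V a)) (B' := fun x => η + C / η * v x)
    (fun x _ => ((hA x).sub_const (A a)).continuousAt.continuousWithinAt)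
    (fun x _ => ((hA x).sub_const (A a)).hasDerivWithinAt) (by simp) (fun x => ?_)
    (fun x hx hxB => ?_) ht).trans (hbarrier_le t ht.2)
  · simpa using (((hasDerivAt_id x).sub_const a).const_mul η).fun_add
      (((hV x).sub_const (V a)).const_mul (C / η))
  · exact hspeed x (hbound x (hxB.trans_le (hbarrier_le x hx.2.le)))

theorem eventually_forall_mem_Icc_dist_lt (hA : ∀ t, HasDerivAt A (A' t) t)
    (hV : ∀ t, HasDerivAt V (v t) t) (hv : ∀ t, 0 ≤ v t) (hC : 0 ≤ C) {p : F} (hρ : 0 < ρ)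
    (hbound : ∀ t, dist (A t) p < ρ → ‖A' t‖ ^ 2 ≤ C * v t) {α : Type*} {l : Filter α}
    {s : α → ℝ} (hp : Tendsto (fun n => A (s n)) l (𝓝 p)) {L ε : ℝ}
    (hL : 0 < L) (hVs : Tendsto (fun n => V (s n + L) - V (s n)) l (𝓝 0)) (hε : 0 < ε) :
    ∀ᶠ n in l, ∀ t ∈ Icc (s n) (s n + L), dist (A t) p < ε := by
  obtain ⟨δ, hδ, hδε, hδρ⟩ : ∃ δ > 0, 2 * δ ≤ ε ∧ 2 * δ ≤ ρ :=
    ⟨min ε ρ / 2, by positivity, by linarith [min_le_left ε ρ], by linarith [min_le_right ε ρ]⟩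
  set η := δ / (2 * L) with hη
  have hsmall : ∀ᶠ n in l, C / η * (V (s n + L) - V (s n)) < δ / 2 := by
    refine (hVs.const_mul (C / η)).eventually_lt_const ?_
    simpa using hδ
  filter_upwards [hsmall, hp.eventually (Metric.ball_mem_nhds p hδ)] with n hn hpn t ht
  have hclose : ∀ x, ‖A x - A (s n)‖ ≤ δ → dist (A x) p < 2 * δ := fun x hx => by
    rw [← dist_eq_norm] at hx
    linarith [dist_triangle (A x) (A (s n)) p, Metric.mem_ball.1 hpn]
  refine (hclose t ?_).trans_le hδε
  refine norm_sub_le_of_norm_deriv_sq_le hA hV hv hC (η := η) (by positivity)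
    (fun x hx => hbound x ((hclose x hx).trans_le hδρ)) ?_ ht
  have hηL : η * (s n + L - s n) = δ / 2 := by rw [hη]; field_simp; ring
  linarith

end Displacement

section Increments

theorem tendsto_add_const_sub_atTop {V : ℝ → ℝ} {y : ℝ} (hV : Tendsto V atTop (𝓝 y)) (L : ℝ) :
    Tendsto (fun t => V (t + L) - V t) atTop (𝓝 0) := by
  simpa using (hV.comp (tendsto_atTop_add_const_right _ L tendsto_id)).sub hV

theorem eventually_exists_mem_Ioo_deriv_lt {V v : ℝ → ℝ} (hV : ∀ t, HasDerivAt V (v t) t) {y : ℝ}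
    (hy : Tendsto V atTop (𝓝 y)) {c δ : ℝ} (hc : 0 < c) (hδ : 0 < δ) :
    ∀ᶠ t in atTop, ∃ ξ ∈ Ioo t (t + δ), v ξ < c := by
  filter_upwards [(tendsto_add_const_sub_atTop hy δ).eventually_lt_const (mul_pos hc hδ)] with t ht
  obtain ⟨ξ, hξ, hslope⟩ := exists_hasDerivAt_eq_slope V v (lt_add_of_pos_right t hδ)
    (fun x _ => (hV x).continuousAt.continuousWithinAt) fun x _ => hV x
  refine ⟨ξ, hξ, ?_⟩
  rwa [hslope, add_sub_cancel_left, div_lt_iff₀ hδ]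

end Increments

section Ascent

theorem exists_eventually_forall_lt_of_periodic {Y : Type*} [TopologicalSpace Y]
    {f : ℝ → Y → ℝ} (hf : Continuous (uncurry f)) {T : ℝ} (hT : 0 < T) (hper : Periodic f T)
    (p : Y) : ∃ C, ∀ᶠ q in 𝓝 p, ∀ t, f t q < C := by
  obtain ⟨C, hC⟩ := isCompact_Icc.bddAbove_image (K := Icc 0 T)
    (f := fun t => f t p) (by fun_prop)
  have hnear : ∀ᶠ q in 𝓝 p, ∀ t ∈ Icc 0 T, f t q < C + 1 :=
    isCompact_Icc.eventually_forall_of_forall_eventually fun t ht =>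
      ((hf.comp continuous_swap).tendsto (p, t)).eventually_lt_const
        ((hC (mem_image_of_mem _ ht)).trans_lt (lt_add_one C))
  refine ⟨C + 1, hnear.mono fun q hq t => ?_⟩
  obtain ⟨r, hr, htr⟩ := hper.exists_mem_Ico₀ hT t
  exact htr ▸ hq r (Ico_subset_Icc_self hr)

variable {F ι : Type*} [NormedAddCommGroup F] [NormedSpace ℝ F] [Fintype ι]

/-- The closed-loop field `∑ k, dV (Z k) • Z k` obtained from the time-dependent control fields
`Z k` by feeding back the derivatives of `V` along them. -/
noncomputable def ascentField (V : F → ℝ) (Z : ι → ℝ → F → F) (t : ℝ) (q : F) : F :=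
  ∑ k, fderiv ℝ V q (Z k t q) • Z k t q

/-- The rate of growth of `V` along the integral curves of `ascentField V Z`. -/
noncomputable def ascentRate (V : F → ℝ) (Z : ι → ℝ → F → F) (t : ℝ) (q : F) : ℝ :=
  ∑ k, fderiv ℝ V q (Z k t q) ^ 2

variable {V : F → ℝ} {Z : ι → ℝ → F → F}

theorem ascentRate_nonneg (t : ℝ) (q : F) : 0 ≤ ascentRate V Z t q :=
  Finset.sum_nonneg fun _ _ => sq_nonneg _

theorem fderiv_ascentField (t : ℝ) (q : F) :
    fderiv ℝ V q (ascentField V Z t q) = ascentRate V Z t q := by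
  simp only [ascentField, ascentRate, map_sum, map_smul, smul_eq_mul, sq]

theorem norm_ascentField_sq_le (t : ℝ) (q : F) :
    ‖ascentField V Z t q‖ ^ 2 ≤ (∑ k, ‖Z k t q‖ ^ 2) * ascentRate V Z t q := by
  calc ‖ascentField V Z t q‖ ^ 2
      ≤ (∑ k, ‖Z k t q‖ * |fderiv ℝ V q (Z k t q)|) ^ 2 := by
        gcongr
        refine norm_sum_le_of_le _ fun k _ => ?_
        rw [norm_smul, Real.norm_eq_abs, mul_comm]
    _ ≤ (∑ k, ‖Z k t q‖ ^ 2) * ∑ k, |fderiv ℝ V q (Z k t q)| ^ 2 :=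
        Finset.sum_mul_sq_le_sq_mul_sq _ _ _
    _ = (∑ k, ‖Z k t q‖ ^ 2) * ascentRate V Z t q := by simp only [sq_abs, ascentRate]

theorem periodic_ascentRate {T : ℝ} (hper : ∀ k, Periodic (Z k) T) :
    Periodic (ascentRate V Z) T := fun t => by
  funext q
  simp only [ascentRate, hper _ t]

theorem continuous_ascentRate (hV : ContDiff ℝ 1 V) (hZ : ∀ k, Continuous (uncurry (Z k))) :
    Continuous (uncurry (ascentRate V Z)) := by
  have hdV : Continuous fun z : ℝ × F => fderiv ℝ V z.2 :=
    (hV.continuous_fderiv one_ne_zero).comp continuous_snd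
  exact continuous_finsetSum _ fun k _ => (hdV.clm_apply (hZ k)).pow 2

variable {A : ℝ → F}

theorem hasDerivAt_comp_of_isIntegralCurve_ascentField (hV : Differentiable ℝ V)
    (hA : IsIntegralCurve A (ascentField V Z)) (t : ℝ) :
    HasDerivAt (V ∘ A) (ascentRate V Z t (A t)) t := by
  rw [← fderiv_ascentField]
  exact (hV (A t)).hasFDerivAt.comp_hasDerivAt t (hA t)

theorem tendsto_comp_of_isIntegralCurve_ascentField (hV : Differentiable ℝ V)
    (hA : IsIntegralCurve A (ascentField V Z)) {s : ℕ → ℝ} (hs : Tendsto s atTop atTop) {p : F}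
    (hp : Tendsto (fun n => A (s n)) atTop (𝓝 p)) : Tendsto (V ∘ A) atTop (𝓝 (V p)) := by
  have hmono : Monotone (V ∘ A) := monotone_of_hasDerivAt_nonneg
    (hasDerivAt_comp_of_isIntegralCurve_ascentField hV hA) fun t => ascentRate_nonneg t (A t)
  exact (tendsto_iff_tendsto_subseq_of_monotone hmono hs).2 ((hV.continuous.tendsto p).comp hp)

theorem eventually_dist_lt_of_isIntegralCurve_ascentField (hV : Differentiable ℝ V)
    (hZ : ∀ k, Continuous (uncurry (Z k))) {T : ℝ} (hT : 0 < T) (hper : ∀ k, Periodic (Z k) T)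
    (hA : IsIntegralCurve A (ascentField V Z)) {s : ℕ → ℝ} (hs : Tendsto s atTop atTop) {p : F}
    (hp : Tendsto (fun n => A (s n)) atTop (𝓝 p)) {L ε : ℝ} (hL : 0 < L) (hε : 0 < ε) :
    ∀ᶠ n in atTop, ∀ t ∈ Icc (s n) (s n + L), dist (A t) p < ε := by
  obtain ⟨C, hC⟩ := exists_eventually_forall_lt_of_periodic
    (f := fun t q => ∑ k, ‖Z k t q‖ ^ 2) (continuous_finsetSum _ fun k _ => (hZ k).norm.pow 2) hT
    (fun t => by simp only [hper _ t]) p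
  obtain ⟨ρ, hρ, hball⟩ := Metric.eventually_nhds_iff.1 hC
  have hC₀ : 0 ≤ C := (Finset.sum_nonneg fun _ _ => sq_nonneg _).trans (hC.self_of_nhds 0).le
  have hlim := tendsto_comp_of_isIntegralCurve_ascentField hV hA hs hp
  refine eventually_forall_mem_Icc_dist_lt hA
    (hasDerivAt_comp_of_isIntegralCurve_ascentField hV hA) (fun t => ascentRate_nonneg t (A t))
    hC₀ hρ (fun t ht => (norm_ascentField_sq_le t (A t)).trans ?_) hp hL ?_ hε
  · exact mul_le_mul_of_nonneg_right (hball ht t).le (ascentRate_nonneg t (A t))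
  · exact (tendsto_add_const_sub_atTop hlim L).comp hs

theorem ascentRate_eq_zero_of_tendsto (hV : ContDiff ℝ 1 V)
    (hZ : ∀ k, Continuous (uncurry (Z k))) {T : ℝ} (hT : 0 < T) (hper : ∀ k, Periodic (Z k) T)
    (hA : IsIntegralCurve A (ascentField V Z)) {s : ℕ → ℝ} (hs : Tendsto s atTop atTop) {p : F}
    (hp : Tendsto (fun n => A (s n)) atTop (𝓝 p)) (t : ℝ) : ascentRate V Z t p = 0 := by
  have hVd : Differentiable ℝ V := hV.differentiable one_ne_zero
  by_contra hne
  obtain ⟨c, hc, hcp⟩ := exists_between ((ascentRate_nonneg t p).lt_of_ne' hne)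
  obtain ⟨δ, hδ, hrate⟩ := Metric.eventually_nhds_iff.1
    (((continuous_ascentRate hV hZ).tendsto (t, p)).eventually_const_lt hcp)
  -- The phase `t` recurs within a period after `s n`, at the time `t + j n • T`.
  choose j hj _ using fun n => existsUnique_add_zsmul_mem_Ico hT t (s n)
  have hstay := eventually_dist_lt_of_isIntegralCurve_ascentField hVd hZ hT hper hA
    hs hp (add_pos hT hδ) hδ
  have hslow := (tendsto_atTop_mono (fun n => (hj n).1) hs).eventually
    (eventually_exists_mem_Ioo_deriv_lt (hasDerivAt_comp_of_isIntegralCurve_ascentField hVd hA)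
      (tendsto_comp_of_isIntegralCurve_ascentField hVd hA hs hp) hc hδ)
  obtain ⟨n, hn, ξ, hξ, hlt⟩ := (hstay.and hslow).exists
  have hphase : ascentRate V Z (ξ - j n • T) = ascentRate V Z ξ :=
    (periodic_ascentRate hper).sub_zsmul_eq (j n)
  have hgt : c < ascentRate V Z (ξ - j n • T) (A ξ) := by
    refine hrate (y := (ξ - j n • T, A ξ)) (max_lt ?_ (hn ξ ⟨?_, ?_⟩))
    · rw [Real.dist_eq, abs_lt]
      constructor <;> linarith [hξ.1, hξ.2]
    · linarith [hξ.1, (hj n).1]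
    · linarith [hξ.2, (hj n).2]
  exact (hphase ▸ hgt).not_gt hlt

theorem fderiv_eq_zero_of_tendsto (hV : ContDiff ℝ 1 V)
    (hZ : ∀ k, Continuous (uncurry (Z k))) {T : ℝ} (hT : 0 < T) (hper : ∀ k, Periodic (Z k) T)
    (hA : IsIntegralCurve A (ascentField V Z)) {s : ℕ → ℝ} (hs : Tendsto s atTop atTop) {p : F}
    (hp : Tendsto (fun n => A (s n)) atTop (𝓝 p)) (t : ℝ) (k : ι) :
    fderiv ℝ V p (Z k t p) = 0 :=
  pow_eq_zero_iff two_ne_zero |>.1 <| (Finset.sum_eq_zero_iff_of_nonneg fun _ _ => sq_nonneg _).1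
    (ascentRate_eq_zero_of_tendsto hV hZ hT hper hA hs hp t) k (Finset.mem_univ k)

end Ascent

section Manifold

theorem hasDerivAt_comp_of_hasMFDerivAt {E : Type*} [NormedAddCommGroup E] [NormedSpace ℝ E]
    {H : Type*} [TopologicalSpace H] {I : ModelWithCorners ℝ E H}
    {M : Type*} [TopologicalSpace M] [ChartedSpace H M]
    {F : Type*} [NormedAddCommGroup F] [NormedSpace ℝ F] {g : M → F} {γ : ℝ → M} {t : ℝ}
    {v : TangentSpace I (γ t)} (hg : MDifferentiableAt I 𝓘(ℝ, F) g (γ t))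
    (hγ : HasMFDerivAt 𝓘(ℝ, ℝ) I γ t ((1 : ℝ →L[ℝ] ℝ).smulRight v)) :
    HasDerivAt (g ∘ γ) (mfderiv I 𝓘(ℝ, F) g (γ t) v) t := by
  let L : ℝ →L[ℝ] F := (mfderiv I 𝓘(ℝ, F) g (γ t)).comp ((1 : ℝ →L[ℝ] ℝ).smulRight v)
  have hL : HasFDerivAt (g ∘ γ) L t := (hg.hasMFDerivAt.comp t hγ).hasFDerivAt
  have hL₁ : L 1 = mfderiv I 𝓘(ℝ, F) g (γ t) v :=
    congrArg (mfderiv I 𝓘(ℝ, F) g (γ t)) (one_smul ℝ v)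
  exact hL₁ ▸ hL.hasDerivAt

theorem inTangentCoordinates_const {𝕜 : Type*} [NontriviallyNormedField 𝕜]
    {E E' : Type*} [NormedAddCommGroup E] [NormedSpace 𝕜 E] [NormedAddCommGroup E']
    [NormedSpace 𝕜 E'] {H H' : Type*} [TopologicalSpace H] [TopologicalSpace H']
    (I : ModelWithCorners 𝕜 E H) (I' : ModelWithCorners 𝕜 E' H')
    {M M' N : Type*} [TopologicalSpace M] [ChartedSpace H M] [IsManifold I 1 M]
    [TopologicalSpace M'] [ChartedSpace H' M'] [IsManifold I' 1 M']
    (a : M) (b : M') (ϕ : N → E →L[𝕜] E') (x₀ : N) :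
    inTangentCoordinates I I' (fun _ => a) (fun _ => b) ϕ x₀ = ϕ := by
  funext x
  rw [inTangentCoordinates_eq (fun _ => a) (fun _ => b) ϕ (mem_chart_source H a)
    (mem_chart_source H' b)]
  ext v
  have hself : (tangentBundleCore I M).coordChange (achart H a) (achart H a) a v = v :=
    (tangentBundleCore I M).coordChange_self _ _ (mem_achart_source H a) v
  have hself' : ∀ u, (tangentBundleCore I' M').coordChange (achart H' b) (achart H' b) b u = u :=
    (tangentBundleCore I' M').coordChange_self _ _ (mem_achart_source H' b)
  simp only [ContinuousLinearMap.comp_apply, hself, hself']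

end Manifold

section Representation

variable {𝕜 : Type*} [NontriviallyNormedField 𝕜] {E : Type*} [NormedAddCommGroup E]
  [NormedSpace 𝕜 E] {H : Type*} [TopologicalSpace H] (I : ModelWithCorners 𝕜 E H)
  {G : Type*} [TopologicalSpace G] [ChartedSpace H G] [Group G]
  {R : Type*} [NormedRing R] [NormedAlgebra 𝕜 R]

/-- The differential at the identity of a representation `π` of `G` in a normed algebra `R`, that
is, the induced map on the Lie algebra. Its values are elements of `R`, to which the tangent space
at `π 1` is identified, so that they can be multiplied. -/
noncomputable def lieDifferential (π : G →* R) : GroupLieAlgebra I G →L[𝕜] R :=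
  mfderiv I 𝓘(𝕜, R) π 1

variable {I} [LieGroup I 1 G] {π : G →* R}

theorem mfderiv_mulInvariantVectorField (hπ : MDifferentiable I 𝓘(𝕜, R) π) (x : G)
    (v : GroupLieAlgebra I G) :
    mfderiv I 𝓘(𝕜, R) π x (mulInvariantVectorField v x) = π x * lieDifferential I π v := by
  have hequivariant : π ∘ (x * ·) = fun z => π x * π z := funext (map_mul π x)
  have hright : HasMFDerivAt I 𝓘(𝕜, R) (fun z => π x * π z) 1
      ((ContinuousLinearMap.mul 𝕜 R (π x)).comp (mfderiv I 𝓘(𝕜, R) π 1)) :=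
    (ContinuousLinearMap.mul 𝕜 R (π x)).hasMFDerivAt.comp (1 : G) (hπ 1).hasMFDerivAt
  have hleft : (mfderiv I 𝓘(𝕜, R) π x (mulInvariantVectorField v x) : R) =
      mfderiv I 𝓘(𝕜, R) (π ∘ (x * ·)) 1 v :=
    (mfderiv_comp_apply_of_eq 1 (hπ x) (contMDiff_mul_left.mdifferentiableAt (n := 1) one_ne_zero)
      (mul_one x) v).symm
  rw [hequivariant, hright.mfderiv] at hleft
  exact hleft

end Representation

section AdjointRepresentation

/-- The trace, as a continuous linear functional on the endomorphisms of `E`, so that it can serve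
as the potential of an `ascentField`. -/
noncomputable def traceCLM (E : Type*) [NormedAddCommGroup E] [NormedSpace ℝ E]
    [FiniteDimensional ℝ E] : (E →L[ℝ] E) →L[ℝ] ℝ :=
  (LinearMap.trace ℝ E ∘ₗ ContinuousLinearMap.coeLM ℝ).toContinuousLinearMap

variable {E : Type*} [NormedAddCommGroup E] [NormedSpace ℝ E]
  {H : Type*} [TopologicalSpace H] (I : ModelWithCorners ℝ E H)
  {G : Type*} [TopologicalSpace G] [ChartedSpace H G] [Group G]

theorem Ad_one : Ad I (1 : G) = .id ℝ (GroupLieAlgebra I G) := by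
  have hconj : (fun y : G => 1 * y * 1⁻¹) = id := by
    funext y
    simp
  rw [Ad, hconj]
  exact mfderiv_id

section

variable [LieGroup I 1 G]

theorem contMDiff_conj (x : G) : ContMDiff I I 1 fun y : G => x * y * x⁻¹ :=
  (contMDiff_const.mul contMDiff_id).mul contMDiff_const

theorem Ad_mul (x y : G) : Ad I (x * y) = (Ad I x).comp (Ad I y) := by
  have hconj : (fun z : G => x * y * z * (x * y)⁻¹) =
      (fun z : G => x * z * x⁻¹) ∘ fun z : G => y * z * y⁻¹ := by
    funext z
    simp [mul_assoc]
  have hone : y * 1 * y⁻¹ = 1 := by rw [mul_one, mul_inv_cancel]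
  rw [Ad, hconj]
  ext v
  exact mfderiv_comp_apply_of_eq 1 ((contMDiff_conj I x).mdifferentiableAt one_ne_zero)
    ((contMDiff_conj I y).mdifferentiableAt one_ne_zero) hone v

variable (G) in
/-- The adjoint representation. The Lie algebra is replaced by the model space `E`, to which it is
equal by definition, because `E` carries a norm. -/
noncomputable def adRep : G →* (E →L[ℝ] E) where
  toFun := Ad I
  map_one' := Ad_one I
  map_mul' := Ad_mul I

end

variable [LieGroup I 2 G]

theorem contMDiff_adRep : ContMDiff I 𝓘(ℝ, E →L[ℝ] E) 1 (adRep I G) := fun x => by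
  have hconj : ContMDiffAt (I.prod I) I 2 (uncurry fun y z : G => y * z * y⁻¹) (x, 1) :=
    ((contMDiff_fst.mul contMDiff_snd).mul contMDiff_fst.inv).contMDiffAt
  have hAd : ContMDiffAt I 𝓘(ℝ, E →L[ℝ] E) 1 (inTangentCoordinates I I (fun _ : G => (1 : G))
      (fun y : G => y * 1 * y⁻¹) (adRep I G) x) x :=
    hconj.mfderiv (m := 1) (fun y z : G => y * z * y⁻¹) (fun _ => 1) contMDiffAt_const
      one_add_one_eq_two.le
  have hone : (fun y : G => y * 1 * y⁻¹) = fun _ => 1 := by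
    funext y
    rw [mul_one, mul_inv_cancel]
  rwa [hone, inTangentCoordinates_const] at hAd

theorem mdifferentiable_adRep : MDifferentiable I 𝓘(ℝ, E →L[ℝ] E) (adRep I G) :=
  (contMDiff_adRep I).mdifferentiable one_ne_zero

/-- The time-dependent control fields on the endomorphisms of `E` to which the adjoint
representation pushes the fields `adField I X xr k` forward. -/
noncomputable def adRepField {m : ℕ} (X : Fin m → GroupLieAlgebra I G) (xr : ℝ → G) (k : Fin m)
    (t : ℝ) (q : E →L[ℝ] E) : E →L[ℝ] E :=
  q * lieDifferential I (adRep I G) (adRep I G (xr t) (X k))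

variable {I} {m : ℕ} {X : Fin m → GroupLieAlgebra I G} {xr : ℝ → G}

theorem continuous_adRepField (hxr : Continuous xr) (k : Fin m) :
    Continuous (uncurry (adRepField I X xr k)) := by
  have hAd : Continuous fun t => adRep I G (xr t) := (contMDiff_adRep I).continuous.comp hxr
  exact continuous_snd.mul ((lieDifferential I (adRep I G)).continuous.comp
    ((hAd.clm_apply continuous_const).comp continuous_fst))

theorem periodic_adRepField {T : ℝ} (hper : Periodic xr T) (k : Fin m) :
    Periodic (adRepField I X xr k) T := fun t => by
  funext q
  simp only [adRepField, hper t]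

theorem mfderiv_adRep_adField (k : Fin m) (t : ℝ) (w : G) :
    mfderiv I 𝓘(ℝ, E →L[ℝ] E) (adRep I G) w (adField I X xr k t w) =
      adRepField I X xr k t (adRep I G w) :=
  mfderiv_mulInvariantVectorField (mdifferentiable_adRep I) w _

variable [FiniteDimensional ℝ E]

theorem feedback_eq_fderiv_traceCLM (k : Fin m) (t : ℝ) (w : G) :
    feedback I X xr k t w =
      fderiv ℝ (traceCLM E) (adRep I G w) (adRepField I X xr k t (adRep I G w)) := by
  have hV : HasMFDerivAt I 𝓘(ℝ, ℝ) (lyapunovV I : G → ℝ) w _ :=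
    (traceCLM E).hasMFDerivAt.comp w (mdifferentiable_adRep I w).hasMFDerivAt
  rw [feedback, hV.mfderiv, ContinuousLinearMap.fderiv, ← mfderiv_adRep_adField]
  rfl

theorem mfderiv_adRep_auxField (t : ℝ) (w : G) :
    mfderiv I 𝓘(ℝ, E →L[ℝ] E) (adRep I G) w (auxField I X xr t w) =
      ascentField (traceCLM E) (adRepField I X xr) t (adRep I G w) := by
  simp only [auxField, ascentField, map_sum, map_smul, feedback_eq_fderiv_traceCLM,
    mfderiv_adRep_adField]
  rfl

theorem isIntegralCurve_adRep_comp {γ : ℝ → G} (hγ : IsTimeIntegralCurve I (auxField I X xr) γ) :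
    IsIntegralCurve (adRep I G ∘ γ) (ascentField (traceCLM E) (adRepField I X xr)) := fun t => by
  rw [comp_apply, ← mfderiv_adRep_auxField]
  exact hasDerivAt_comp_of_hasMFDerivAt (mdifferentiable_adRep I (γ t)) (hγ t)

end AdjointRepresentation

end PeriodicTracking

open PeriodicTracking in
theorem mainTheorem2_general
    {E : Type*} [NormedAddCommGroup E] [NormedSpace ℝ E] [FiniteDimensional ℝ E]
    {H : Type*} [TopologicalSpace H] (I : ModelWithCorners ℝ E H)
    {G : Type*} [TopologicalSpace G] [ChartedSpace H G] [Group G] [LieGroup I 2 G]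
    {m : ℕ} (X : Fin m → GroupLieAlgebra I G) {T : ℝ} {xr : ℝ → G} (hT : 0 < T)
    (hxr : Continuous xr) (hper : Function.Periodic xr T) (t₀ : ℝ) (w₀ w : G)
    (hw : w ∈ omegaLimitSet I (auxField I X xr) t₀ w₀) :
    (∀ (t : ℝ) (k : Fin m), feedback I X xr k t w = 0) ∧
      w ∈ criticalPoints I (auxField I X xr) := by
  obtain ⟨γ, hγ, -, s, -, hs, hsw⟩ := hw
  have hAd : Tendsto (fun n => adRep I G (γ (s n))) atTop (𝓝 (adRep I G w)) :=
    ((contMDiff_adRep I).continuous.tendsto w).comp hsw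
  have hzero : ∀ (t : ℝ) (k : Fin m), feedback I X xr k t w = 0 := fun t k => by
    rw [feedback_eq_fderiv_traceCLM]
    exact fderiv_eq_zero_of_tendsto (traceCLM E).contDiff (continuous_adRepField hxr) hT
      (periodic_adRepField hper) (isIntegralCurve_adRep_comp hγ) hs hAd t k
  refine ⟨hzero, fun t => ?_⟩
  simp only [auxField, hzero, zero_smul, Finset.sum_const_zero]

theorem mainTheorem2
    {E : Type*} [NormedAddCommGroup E] [NormedSpace ℝ E] [FiniteDimensional ℝ E]
    {H : Type*} [TopologicalSpace H] (I : ModelWithCorners ℝ E H) [I.Boundaryless]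
    {G : Type*} [TopologicalSpace G] [ChartedSpace H G] [Group G] [LieGroup I ∞ G]
    [T2Space G] [CompactSpace G] [ConnectedSpace G]
    {m : ℕ} (X : Fin m → GroupLieAlgebra I G)
    {T : ℝ} {xr : ℝ → G} {ur : Fin m → ℝ → ℝ}
    (hr : PeriodicTracking.IsPeriodicTrajectory I X T xr ur)
    (t₀ : ℝ) (w₀ w : G)
    (hw : w ∈ PeriodicTracking.omegaLimitSet I (PeriodicTracking.auxField I X xr) t₀ w₀) :
    (∀ (t : ℝ) (k : Fin m), PeriodicTracking.feedback I X xr k t w = 0) ∧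
      w ∈ PeriodicTracking.criticalPoints I (PeriodicTracking.auxField I X xr) := by
  have hxr : Continuous xr :=
    continuous_iff_continuousAt.2 fun t => (hr.isTimeIntegralCurve t).continuousAt
  exact mainTheorem2_general I X hr.period_pos hxr hr.periodic_curve t₀ w₀ w hw
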